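/- Let $p$ be a prime and $m\ge 1$ an integer, with $m\ge 2$ if $p=2$, and put $q=p^m$. For $t\in\mathbb F_q^*$ and a primitive $p$-th root of unity $\zeta$ in a field of characteristic $0$, define the Kloosterman sum $$Kl_q(t)=Kl_{q,\zeta}(t):=\sum_{x\in\mathbb F_q^*}\zeta^{\mathrm{Tr}_{\mathbb F_q/\mathbb F_p}(x+t/x)}.$$ Then for every $t\in\mathbb F_q^*$ the following hold. 1. For every $\pi\in\overline{\mathbb Q}_p$ with $\pi^{p-1}=-p$ and every primitive $p$-th root of unity $\zeta\in\overline{\mathbb Q}_p$, one has $-Kl_q(t)\equiv 1 \pmod{\pi^2}$ in $\mathbb Z_p[\pi]$, that is, $-Kl_q(t)-1\in\pi^2\,\mathbb Z_p[\pi]$. 2. For every primitive $p$-th root of unity $\zeta\in\mathbb C$, the number $Kl_q(t)$ is real and satisfies $Kl_q(t)^2<4q$. -/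

import Mathlib

/-- The Kloosterman sum `∑_{x ∈ F^*} ζ ^ Tr(x + t / x)` over a finite field `F` of characteristic `p`,
with `Tr` the absolute trace `F → 𝔽_p` and `ζ` an element of a commutative ring with `ζ ^ p = 1`
(for such `ζ` the power does not depend on the integer that represents the trace). -/
noncomputable def kloostermanSum (p : ℕ) {F : Type*} [Field F] [Fintype F] [DecidableEq F]
    [Algebra (ZMod p) F] {R : Type*} [CommRing R] (ζ : R) (t : Fˣ) : R :=
  ∑ x : Fˣ, ζ ^ (Algebra.trace (ZMod p) F ((x : F) + (t : F) / (x : F))).val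

/-! Congruence: `ζ - 1` is a multiple of `π` in `ℤ_p[π]`, so `ζ ^ n` is `1 + n(ζ - 1)` modulo `π ^
2`. Summed over `x`, the constant terms give `q - 1`. The linear term vanishes modulo `π ^ 2`
because the traces sum to `0` in `𝔽_p`, and `q` itself lies in `(π ^ 2)`.

Bound: substituting `-x` for `x` shows that `Kl` is real. Over the quadratic extension, `Kl_{q^2}(t)
= 2q - Kl_q(t)^2`, so an excess `|Kl_q| ≥ (2 + δ)√q` becomes at least `(2 + 4δ)√(q^2)`. Iterating
makes the excess unbounded, while Stepanov's method (`norm_kloostermanSum_le`) gives `|Kl| ≤ (2p +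
1)√q` whenever `q = p^(2(k+1))`, `k ≥ 1`. Hence `|Kl_q| ≤ 2√q`. Equality is excluded arithmetically:
`Kl ≡ q - 1` modulo `ζ - 1`, so `Kl^2 = 4q` would force `1/p` to be an algebraic integer. -/

/-! ### The congruence modulo `π ^ 2` -/

/-- Power series can be evaluated at `π` without any topology on `L`: `X ^ n + p` is distinguished,
so Weierstrass division identifies `ℤ_p[[X]]/(X ^ n + p)` with the same quotient of `ℤ_p[X]`. -/
theorem exists_powerSeries_algHom_of_pow_eq_neg_prime (p : ℕ) [Fact p.Prime] {L : Type*} [CommRing L]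
    [Algebra ℤ_[p] L] (π : L) {n : ℕ} (hn : n ≠ 0) (hπ : π ^ n = -(p : L)) :
    ∃ Φ : PowerSeries ℤ_[p] →ₐ[ℤ_[p]] L, Φ PowerSeries.X = π ∧
      ∀ f, Φ f ∈ Algebra.adjoin ℤ_[p] {π} := by
  set g : Polynomial ℤ_[p] := Polynomial.X ^ n + Polynomial.C (p : ℤ_[p]) with hg
  have hdeg : g.natDegree = n := Polynomial.natDegree_X_pow_add_C
  have hd : g.IsDistinguishedAt (IsLocalRing.maximalIdeal ℤ_[p]) := by
    refine { mem := ?_, monic := Polynomial.monic_X_pow_add_C _ hn }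
    intro i hi
    rw [hdeg] at hi
    rw [hg, Polynomial.coeff_add, Polynomial.coeff_X_pow, if_neg hi.ne, zero_add,
      Polynomial.coeff_C]
    split_ifs
    · rw [PadicInt.maximalIdeal_eq_span_p]
      exact Ideal.mem_span_singleton_self _
    · exact zero_mem _
  have hker : ∀ a ∈ Ideal.span {g}, Polynomial.aeval π a = 0 := by
    intro a ha
    obtain ⟨b, rfl⟩ := Ideal.mem_span_singleton.1 ha
    simp [hg, hπ]
  let ψ : (Polynomial ℤ_[p] ⧸ Ideal.span {g}) →ₐ[ℤ_[p]] L :=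
    Ideal.Quotient.liftₐ (Ideal.span {g}) (Polynomial.aeval π) hker
  refine ⟨ψ.comp (hd.algEquivQuotient.symm.toAlgHom.comp
    (Ideal.Quotient.mkₐ ℤ_[p] _)), ?_, ?_⟩
  · have h1 : hd.algEquivQuotient (Ideal.Quotient.mk _ Polynomial.X) =
        Ideal.Quotient.mk _ PowerSeries.X := by
      simp
    have h2 : hd.algEquivQuotient.symm (Ideal.Quotient.mk _ PowerSeries.X) =
        Ideal.Quotient.mk _ Polynomial.X := by
      rw [← h1, AlgEquiv.symm_apply_apply]
    change ψ (hd.algEquivQuotient.symm (Ideal.Quotient.mk _ PowerSeries.X)) = π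
    rw [h2]
    change Polynomial.aeval π Polynomial.X = π
    simp
  · intro f
    obtain ⟨r, hr⟩ := Ideal.Quotient.mk_surjective
      (hd.algEquivQuotient.symm (Ideal.Quotient.mk _ f))
    change ψ (hd.algEquivQuotient.symm (Ideal.Quotient.mk _ f)) ∈ _
    rw [← hr]
    exact Polynomial.aeval_mem_adjoin_singleton _ _

-- The equation is `(1 + πx)^p = 1` divided by `π ^ p`, with `π` replaced by the variable `X` (see
-- `one_add_mul_pow_prime_eq`). Modulo `X` it is `x ^ p - x = 0`, with root `1` and derivative `p -
-- 1`, a unit, so Hensel's lemma applies `X`-adically.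
open PowerSeries in
theorem exists_powerSeries_dwork_root (p : ℕ) [Fact p.Prime] :
    ∃ x : PowerSeries ℤ_[p], IsUnit x ∧
      x ^ p - x - ∑ k ∈ Finset.Ico 2 p, ((p.choose k / p : ℕ) : PowerSeries ℤ_[p]) *
        PowerSeries.X ^ (k - 1) * x ^ k = 0 := by
  have hp := (Fact.out : p.Prime)
  have : HenselianRing (PowerSeries ℤ_[p]) (Ideal.span {PowerSeries.X}) := inferInstance
  set r : Polynomial (PowerSeries ℤ_[p]) := -Polynomial.X - ∑ k ∈ Finset.Ico 2 p,
    Polynomial.C (((p.choose k / p : ℕ) : PowerSeries ℤ_[p]) *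
        PowerSeries.X ^ (k - 1)) * Polynomial.X ^ k with hr
  have hrdeg : r.degree < p := by
    refine (Polynomial.degree_sub_le _ _).trans_lt (max_lt ?_ ?_)
    · rw [Polynomial.degree_neg, Polynomial.degree_X]
      exact_mod_cast hp.one_lt
    · refine (Polynomial.degree_sum_le _ _).trans_lt ?_
      rw [Finset.sup_lt_iff (by exact_mod_cast WithBot.bot_lt_coe p)]
      intro k hk
      refine (Polynomial.degree_C_mul_X_pow_le _ _).trans_lt ?_
      exact_mod_cast (Finset.mem_Ico.1 hk).2
  have hsum : ∀ c : ℕ → PowerSeries ℤ_[p], ∑ k ∈ Finset.Ico 2 p, ((p.choose k / p : ℕ) :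
      PowerSeries ℤ_[p]) * PowerSeries.X ^ (k - 1) * c k ∈
      Ideal.span {(PowerSeries.X : PowerSeries ℤ_[p])} := by
    intro c
    refine Ideal.sum_mem _ fun k hk => ?_
    refine Ideal.mul_mem_right _ _ (Ideal.mul_mem_left _ _ ?_)
    refine Ideal.pow_mem_of_mem _ (Ideal.mem_span_singleton_self _) _ ?_
    have := (Finset.mem_Ico.1 hk).1
    omega
  obtain ⟨x, hx, hx1⟩ := HenselianRing.is_henselian (I := Ideal.span {(PowerSeries.X : PowerSeries ℤ_[p])})
    (Polynomial.X ^ p + r) (Polynomial.monic_X_pow_add hrdeg) 1 (by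
      have := neg_mem (hsum fun _ => 1)
      convert this using 1
      simp [hr, Polynomial.eval_finsetSum]
      ring) (by
      have h2 := hsum fun k => (k : PowerSeries ℤ_[p])
      have h3 : (Polynomial.derivative (Polynomial.X ^ p + r)).eval 1 =
          ((p : PowerSeries ℤ_[p]) - 1) - ∑ k ∈ Finset.Ico 2 p, ((p.choose k / p : ℕ) :
      PowerSeries ℤ_[p]) * PowerSeries.X ^ (k - 1) * (k : PowerSeries ℤ_[p]) := by
        simp only [hr, Polynomial.derivative_add, Polynomial.derivative_X_pow,
          Polynomial.derivative_sub, Polynomial.derivative_neg, Polynomial.derivative_X,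
          Polynomial.derivative_sum, Polynomial.derivative_C_mul_X_pow, Polynomial.eval_add,
          Polynomial.eval_sub, Polynomial.eval_neg, Polynomial.eval_finsetSum,
          Polynomial.eval_mul, Polynomial.eval_C, Polynomial.eval_pow, Polynomial.eval_X,
          one_pow, mul_one, Polynomial.eval_one]
        ring
      rw [h3, map_sub, Ideal.Quotient.eq_zero_iff_mem.2 h2, sub_zero]
      refine IsUnit.map _ ?_
      rw [← neg_sub, IsUnit.neg_iff, PowerSeries.isUnit_iff_constantCoeff]
      rw [map_sub, map_one, map_natCast]
      refine IsLocalRing.isUnit_one_sub_self_of_mem_nonunits _ ?_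
      exact PadicInt.p_nonunit)
  refine ⟨x, ?_, ?_⟩
  · rw [PowerSeries.isUnit_iff_constantCoeff]
    obtain ⟨y, hy⟩ := Ideal.mem_span_singleton.1 hx1
    have : x = 1 + PowerSeries.X * y := by rw [← hy]; ring
    rw [this]
    simp
  · have := hx
    rw [Polynomial.IsRoot.def] at this
    rw [← this]
    simp only [hr, Polynomial.eval_add, Polynomial.eval_sub, Polynomial.eval_neg,
      Polynomial.eval_finsetSum, Polynomial.eval_mul, Polynomial.eval_C, Polynomial.eval_pow,
      Polynomial.eval_X]
    ring

theorem one_add_mul_pow_prime_eq {R : Type*} [CommRing R] {p : ℕ} (hp : p.Prime) {π : R}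
    (hπ : π ^ (p - 1) = -(p : R)) (x : R) :
    (1 + π * x) ^ p = 1 + π ^ p * (x ^ p - x -
      ∑ k ∈ Finset.Ico 2 p, ((p.choose k / p : ℕ) : R) * π ^ (k - 1) * x ^ k) := by
  have h2 := hp.two_le
  have hpp : π ^ p = -(p : R) * π := by
    rw [← hπ, ← pow_succ, Nat.sub_add_cancel hp.one_le]
  rw [add_comm 1, add_pow, Finset.range_eq_Ico, Finset.sum_Ico_succ_top (Nat.zero_le p),
    ← Finset.sum_Ico_consecutive _ (Nat.zero_le 2) h2]
  have h3 : ∀ k ∈ Finset.Ico 2 p, (π * x) ^ k * 1 ^ (p - k) * (p.choose k : R) =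
      -(π ^ p * (((p.choose k / p : ℕ) : R) * π ^ (k - 1) * x ^ k)) := by
    intro k hk
    rw [Finset.mem_Ico] at hk
    have hdvd : p ∣ p.choose k := hp.dvd_choose_self (by omega) hk.2
    have hc : (p.choose k : R) = p * ((p.choose k / p : ℕ) : R) := by
      rw [← Nat.cast_mul, Nat.mul_div_cancel' hdvd]
    have hk1 : π ^ k = π ^ (k - 1) * π := by rw [← pow_succ, Nat.sub_add_cancel (by omega)]
    rw [hc, hpp, mul_pow, hk1, one_pow]
    ring
  rw [Finset.sum_congr rfl h3, Finset.sum_neg_distrib, ← Finset.mul_sum]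
  simp [Finset.sum_range_succ, mul_pow]
  linear_combination x * hpp

/-- Evaluating the Hensel root at `π` yields one primitive `p`-th root of unity `1 + πΦ(x)` with the
property; `ζ` is a power of it, and a geometric sum transfers the divisibility. -/
theorem IsPrimitiveRoot.exists_sub_one_eq_mul_of_pow_eq_neg_prime {p : ℕ} [Fact p.Prime]
    {L : Type*} [Field L] [Algebra ℤ_[p] L] [FaithfulSMul ℤ_[p] L] {π ζ : L}
    (hπ : π ^ (p - 1) = -(p : L)) (hζ : IsPrimitiveRoot ζ p) :
    ∃ d ∈ Algebra.adjoin ℤ_[p] {π}, ζ - 1 = π * d := by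
  have hp := (Fact.out : p.Prime)
  have hp0 : (p : L) ≠ 0 := by
    have : (algebraMap ℤ_[p] L) p ≠ 0 := by
      rw [Ne, FaithfulSMul.algebraMap_eq_zero_iff]
      exact_mod_cast hp.ne_zero
    simpa using this
  have hpp : p - 1 ≠ 0 := Nat.sub_ne_zero_of_lt hp.one_lt
  have hπ0 : π ≠ 0 := by
    rintro rfl
    rw [zero_pow hpp] at hπ
    exact hp0 (neg_eq_zero.1 hπ.symm)
  obtain ⟨Φ, hX, hΦ⟩ := exists_powerSeries_algHom_of_pow_eq_neg_prime p π hpp hπ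
  obtain ⟨x, hxu, hx⟩ := exists_powerSeries_dwork_root p
  have hx' := congrArg Φ hx
  simp only [map_sub, map_sum, map_mul, map_pow, map_natCast, map_zero, hX] at hx'
  have hroot : (1 + π * Φ x) ^ p = 1 := by
    rw [one_add_mul_pow_prime_eq hp hπ, hx', mul_zero, add_zero]
  have hne : 1 + π * Φ x ≠ 1 := by
    simpa [hπ0] using (hxu.map Φ).ne_zero
  have hprim : IsPrimitiveRoot (1 + π * Φ x) p :=
    IsPrimitiveRoot.iff_orderOf.2 (orderOf_eq_prime hroot hne)
  obtain ⟨k, -, hk⟩ := hprim.eq_pow_of_pow_eq_one hζ.pow_eq_one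
  have hπmem : π ∈ Algebra.adjoin ℤ_[p] {π} := Algebra.self_mem_adjoin_singleton _ _
  refine ⟨Φ x * ∑ i ∈ Finset.range k, (1 + π * Φ x) ^ i, mul_mem (hΦ x) (sum_mem fun i _ =>
    pow_mem (add_mem (one_mem _) (mul_mem hπmem (hΦ x))) i), ?_⟩
  rw [← hk]
  have := geom_sum_mul (1 + π * Φ x) k
  linear_combination -this

theorem exists_mem_pow_eq_one_add {R A : Type*} [CommRing R] [SetLike A R] [SubringClass A R]
    (S : A) {ζ : R} (hζ : ζ ∈ S) (n : ℕ) :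
    ∃ e ∈ S, ζ ^ n = 1 + n * (ζ - 1) + (ζ - 1) ^ 2 * e := by
  induction n with
  | zero => exact ⟨0, zero_mem _, by simp⟩
  | succ n ih =>
    obtain ⟨e, he, h⟩ := ih
    refine ⟨n + ζ * e, add_mem (natCast_mem _ _) (mul_mem hζ he), ?_⟩
    rw [pow_succ, h]
    push_cast
    ring

/-- For `q > 2` both `∑ x` and `∑ 1/x` over the units vanish. This fails for `q = 2`, hence `m ≥ 2`
when `p = 2`. -/
theorem sum_val_trace_add_div_dvd {p : ℕ} [Fact p.Prime] {F : Type*} [Field F] [Fintype F]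
    [DecidableEq F] [Algebra (ZMod p) F] (hF : 2 < Fintype.card F) (t : Fˣ) :
    p ∣ ∑ x : Fˣ, (Algebra.trace (ZMod p) F ((x : F) + (t : F) / (x : F))).val := by
  rw [← ZMod.natCast_eq_zero_iff]
  push_cast
  simp only [ZMod.natCast_val, ZMod.cast_id]
  have h1 : ∑ x : Fˣ, (x : F) = 0 := by
    have := FiniteField.sum_pow_units F 1
    rw [if_neg (by rw [Nat.dvd_one]; omega)] at this
    simpa using this
  have h2 : ∑ x : Fˣ, ((x : F))⁻¹ = 0 := by
    rw [← h1]
    exact Fintype.sum_equiv (Equiv.inv Fˣ) _ _ (fun x => by simp)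
  rw [← map_sum, Finset.sum_add_distrib, h1]
  simp only [div_eq_mul_inv, ← Finset.mul_sum, h2]
  simp

theorem exists_neg_kloostermanSum_sub_one_eq {p : ℕ} [Fact p.Prime] {m : ℕ}
    (hpm : (3 ≤ p ∧ 1 ≤ m) ∨ (p = 2 ∧ 2 ≤ m))
    {F : Type*} [Field F] [Fintype F] [DecidableEq F] [Algebra (ZMod p) F]
    (hF : Fintype.card F = p ^ m) (t : Fˣ)
    {L : Type*} [Field L] [Algebra ℤ_[p] L] [FaithfulSMul ℤ_[p] L] {π ζ : L}
    (hπ : π ^ (p - 1) = -(p : L)) (hζ : IsPrimitiveRoot ζ p) :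
    ∃ c ∈ Algebra.adjoin ℤ_[p] {π}, -kloostermanSum p ζ t - 1 = π ^ 2 * c := by
  have hp := (Fact.out : p.Prime)
  have hπmem : π ∈ Algebra.adjoin ℤ_[p] {π} := Algebra.self_mem_adjoin_singleton _ _
  obtain ⟨d, hd, hζd⟩ := hζ.exists_sub_one_eq_mul_of_pow_eq_neg_prime hπ
  have hζmem : ζ ∈ Algebra.adjoin ℤ_[p] {π} := by
    rw [show ζ = 1 + π * d by rw [← hζd]; ring]
    exact add_mem (one_mem _) (mul_mem hπmem hd)
  have hcard : 2 < Fintype.card F := by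
    rw [hF]
    rcases hpm with ⟨h1, h2⟩ | ⟨rfl, h2⟩
    · calc 2 < p := h1
        _ = p ^ 1 := (pow_one p).symm
        _ ≤ p ^ m := Nat.pow_le_pow_right hp.pos h2
    · calc 2 < 2 ^ 2 := by norm_num
        _ ≤ 2 ^ m := Nat.pow_le_pow_right hp.pos h2
  obtain ⟨N, hN⟩ := sum_val_trace_add_div_dvd (p := p) hcard t
  have hpπ : (p : L) * π = -π ^ p := by
    rw [← Nat.sub_add_cancel hp.one_le, pow_succ, hπ, Nat.sub_add_cancel hp.one_le]; ring
  -- For odd `p`, `p = -π ^ (p - 1)` with `p - 1 ≥ 2`; for `p = 2`, `π = -2` and `4 ∣ q`.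
  obtain ⟨a, ha, hqa⟩ : ∃ a ∈ Algebra.adjoin ℤ_[p] {π}, (p : L) ^ m = π ^ 2 * a := by
    rcases hpm with ⟨h1, h2⟩ | ⟨rfl, h2⟩
    · refine ⟨-π ^ (p - 3) * p ^ (m - 1), mul_mem (neg_mem (pow_mem hπmem _))
        (pow_mem (natCast_mem _ _) _), ?_⟩
      obtain ⟨m, rfl⟩ := Nat.exists_eq_add_of_le h2
      have h3 : (p : L) = -(π ^ 2 * π ^ (p - 3)) := by
        rw [← pow_add, show 2 + (p - 3) = p - 1 by omega, hπ, neg_neg]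
      rw [Nat.add_sub_cancel_left, pow_add, pow_one]
      linear_combination (p : L) ^ m * h3
    · refine ⟨(2 : ℕ) ^ (m - 2), pow_mem (natCast_mem _ _) _, ?_⟩
      obtain ⟨m, rfl⟩ := Nat.exists_eq_add_of_le h2
      have h3 : π = -((2 : ℕ) : L) := by simpa using hπ
      rw [h3, Nat.add_sub_cancel_left, pow_add]
      ring
  choose e he hζe using exists_mem_pow_eq_one_add (Algebra.adjoin ℤ_[p] {π}) hζmem
  have hkl : kloostermanSum p ζ t = ((p : L) ^ m - 1) + (p * N : ℕ) * (ζ - 1) + (ζ - 1) ^ 2 *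
      ∑ x : Fˣ, e (Algebra.trace (ZMod p) F ((x : F) + (t : F) / (x : F))).val := by
    rw [← hN, kloostermanSum, Finset.sum_congr rfl fun x _ => hζe _, Finset.sum_add_distrib,
      Finset.sum_add_distrib, Nat.cast_sum, Finset.sum_mul, Finset.mul_sum]
    congr 2
    rw [Finset.sum_const, Finset.card_univ, Fintype.card_units, hF, nsmul_eq_mul, mul_one,
      Nat.cast_sub (Nat.one_le_pow _ _ hp.pos)]
    push_cast
    ring
  refine ⟨-a + π ^ (p - 2) * d * N - d ^ 2 *
      ∑ x : Fˣ, e (Algebra.trace (ZMod p) F ((x : F) + (t : F) / (x : F))).val,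
    sub_mem (add_mem (neg_mem ha) (mul_mem (mul_mem (pow_mem hπmem _) hd) (natCast_mem _ _)))
      (mul_mem (pow_mem hd _) (sum_mem fun x _ => he _)), ?_⟩
  have hpπ2 : (p : L) * π = -(π ^ 2 * π ^ (p - 2)) := by
    rw [hpπ, ← pow_add, show 2 + (p - 2) = p by have := hp.two_le; omega]
  rw [hkl, hζd, hqa]
  push_cast
  linear_combination (-(N : L) * d) * hpπ2

/-! ### Kloosterman sums over a quadratic extension -/

theorem kloostermanSum_eq_sum_addChar {p : ℕ} [Fact p.Prime] {F : Type*} [Field F] [Fintype F]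
    [DecidableEq F] [Algebra (ZMod p) F] {R : Type*} [CommRing R] {ζ : R} (hζ : ζ ^ p = 1)
    (t : Fˣ) :
    kloostermanSum p ζ t = ∑ x : Fˣ,
      AddChar.zmodChar p hζ (Algebra.trace (ZMod p) F ((x : F) + (t : F) / (x : F))) :=
  rfl

theorem sum_zmodChar_trace_mul {p : ℕ} [Fact p.Prime] {F : Type*} [Field F] [Fintype F]
    [Algebra (ZMod p) F] {R : Type*} [CommRing R] [IsDomain R] {ζ : R}
    (hζ : IsPrimitiveRoot ζ p) {c : F} (hc : c ≠ 0) :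
    ∑ s : F, AddChar.zmodChar p hζ.pow_eq_one (Algebra.trace (ZMod p) F (s * c)) = 0 := by
  set ψ : AddChar F R := (AddChar.zmodChar p hζ.pow_eq_one).compAddMonoidHom
    ((Algebra.trace (ZMod p) F).toAddMonoidHom.comp (AddMonoidHom.mulRight c)) with hψ
  have hne : ψ ≠ 1 := by
    obtain ⟨a, ha⟩ := Algebra.trace_surjective (ZMod p) F 1
    rw [AddChar.ne_one_iff]
    refine ⟨a * c⁻¹, ?_⟩
    have hval : ψ (a * c⁻¹) = ζ ^ (1 : ZMod p).val := by
      simp [hψ, AddChar.zmodChar_apply, hc, ha]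
    rw [hval, ZMod.val_one, pow_one]
    exact hζ.ne_one (Fact.out : p.Prime).one_lt
  exact AddChar.sum_eq_zero_of_ne_one hne

theorem sum_comp_eq_sum_card_mul {ι κ R : Type*} [Fintype ι] [Fintype κ] [DecidableEq κ]
    [CommRing R] (g : κ → R) (f : ι → κ) :
    ∑ i, g (f i) = ∑ v, ((Finset.univ.filter fun i => f i = v).card : R) * g v := by
  rw [← Finset.sum_fiberwise Finset.univ f]
  refine Finset.sum_congr rfl fun v _ => ?_
  rw [Finset.sum_congr rfl (g := fun _ => g v) (fun i hi => by rw [(Finset.mem_filter.1 hi).2])]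
  simp

section Quadratic

variable {F E : Type*} [Field F] [Fintype F] [Field E] [Fintype E] [Algebra F E]

theorem algebraMap_trace_of_finrank_eq_two (h2 : Module.finrank F E = 2) (z : E) :
    algebraMap F E (Algebra.trace F E z) = z + z ^ Fintype.card F := by
  rw [FiniteField.algebraMap_trace_eq_sum_pow, h2]
  simp [Finset.sum_range_succ]

theorem algebraMap_norm_of_finrank_eq_two (h2 : Module.finrank F E = 2) (z : E) :
    algebraMap F E (Algebra.norm F z) = z * z ^ Fintype.card F := by
  rw [FiniteField.algebraMap_norm_eq_prod_pow, h2]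
  simp [Finset.prod_range_succ]

theorem trace_add_div_of_finrank_eq_two (h2 : Module.finrank F E = 2) {z : E} (hz : z ≠ 0)
    (t : F) : Algebra.trace F E (z + algebraMap F E t / z) =
      Algebra.trace F E z * (1 + t / Algebra.norm F z) := by
  apply FaithfulSMul.algebraMap_injective F E
  have hz' : z ^ Fintype.card F ≠ 0 := pow_ne_zero _ hz
  rw [map_add (Algebra.trace F E), div_eq_mul_inv, ← Algebra.smul_def, map_smul, smul_eq_mul,
    map_add, map_mul, map_mul, map_add, map_one, map_div₀, algebraMap_trace_of_finrank_eq_two h2,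
    algebraMap_trace_of_finrank_eq_two h2, algebraMap_norm_of_finrank_eq_two h2, inv_pow]
  field_simp
  ring

variable [DecidableEq F]

/-- Both sets list roots of `X ^ 2 - sX + n`: the `w` are ordered pairs of roots in `F`, the `z`
roots whose conjugate is the other root. If a pair `(x, y)` exists, a `z` can occur only when `x =
y`, and then there is one of each kind. -/
theorem card_trace_norm_add_card_add_mul_le (h2 : Module.finrank F E = 2) (s n : F) :
    (Finset.univ.filter fun z : E => (Algebra.trace F E z, Algebra.norm F z) = (s, n)).card +
      (Finset.univ.filter fun w : F × F => (w.1 + w.2, w.1 * w.2) = (s, n)).card ≤ 2 := by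
  classical
  have hquad : ∀ z : E, (Algebra.trace F E z, Algebra.norm F z) = (s, n) → ∀ u : E,
      u ^ 2 - algebraMap F E s * u + algebraMap F E n = (u - z) * (u - (algebraMap F E s - z)) := by
    intro z hz u
    obtain ⟨h1, h3⟩ := Prod.mk.inj hz
    have h4 := algebraMap_trace_of_finrank_eq_two h2 z
    have h5 := algebraMap_norm_of_finrank_eq_two h2 z
    rw [h1] at h4
    rw [h3] at h5
    rw [h5, h4]
    ring
  have hroot : ∀ z : E, (Algebra.trace F E z, Algebra.norm F z) = (s, n) →
      z ^ 2 - algebraMap F E s * z + algebraMap F E n = 0 := by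
    intro z hz
    rw [hquad z hz z, sub_self, zero_mul]
  by_cases hw : ∃ w : F × F, (w.1 + w.2, w.1 * w.2) = (s, n)
  · obtain ⟨⟨x, y⟩, hxy⟩ := hw
    obtain ⟨rfl, rfl⟩ := Prod.mk.inj hxy
    have hz : ∀ z : E, (Algebra.trace F E z, Algebra.norm F z) = (x + y, x * y) →
        z = algebraMap F E x ∧ x = y := by
      intro z hz
      have h3 := hroot z hz
      have h4 : (z - algebraMap F E x) * (z - algebraMap F E y) = 0 := by
        rw [← h3, map_add, map_mul]
        ring
      obtain ⟨h5, h6⟩ := Prod.mk.inj hz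
      rcases mul_eq_zero.1 h4 with h | h
      · rw [sub_eq_zero] at h
        subst h
        rw [Algebra.norm_algebraMap, h2] at h6
        rw [Algebra.trace_algebraMap, h2, two_nsmul] at h5
        exact ⟨rfl, add_left_cancel h5⟩
      · rw [sub_eq_zero] at h
        subst h
        rw [Algebra.trace_algebraMap, h2, two_nsmul] at h5
        have := add_right_cancel h5
        exact ⟨by rw [this], this.symm⟩
    have hp : ∀ w : F × F, (w.1 + w.2, w.1 * w.2) = (x + y, x * y) → w = (x, y) ∨ w = (y, x) := by
      rintro ⟨a, b⟩ hab
      obtain ⟨h5, h6⟩ := Prod.mk.inj hab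
      simp only at h5 h6
      have h7 : (a - x) * (a - y) = 0 := by linear_combination a * h5 - h6
      rcases mul_eq_zero.1 h7 with h | h
      · rw [sub_eq_zero] at h
        subst h
        exact Or.inl (by rw [add_left_cancel h5])
      · rw [sub_eq_zero] at h
        subst h
        rw [add_comm x] at h5
        exact Or.inr (by rw [add_left_cancel h5])
    by_cases hxy' : x = y
    · have h8 : (Finset.univ.filter fun z : E =>
          (Algebra.trace F E z, Algebra.norm F z) = (x + y, x * y)) ⊆ {algebraMap F E x} := by
        intro z h
        rw [Finset.mem_filter] at h
        exact Finset.mem_singleton.2 (hz z h.2).1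
      have h9 : (Finset.univ.filter fun w : F × F =>
          (w.1 + w.2, w.1 * w.2) = (x + y, x * y)) ⊆ {(x, y)} := by
        intro w h
        rw [Finset.mem_filter] at h
        rcases hp w h.2 with h | h
        · exact Finset.mem_singleton.2 h
        · subst hxy'
          exact Finset.mem_singleton.2 h
      exact add_le_add (Finset.card_le_card h8) (Finset.card_le_card h9)
    · have h8 : (Finset.univ.filter fun z : E =>
          (Algebra.trace F E z, Algebra.norm F z) = (x + y, x * y)) = ∅ :=
        Finset.filter_eq_empty_iff.2 fun z _ h => hxy' (hz z h).2
      have h9 : (Finset.univ.filter fun w : F × F =>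
          (w.1 + w.2, w.1 * w.2) = (x + y, x * y)) ⊆ {(x, y), (y, x)} := by
        intro w h
        rw [Finset.mem_filter] at h
        rw [Finset.mem_insert, Finset.mem_singleton]
        exact hp w h.2
      rw [h8, Finset.card_empty, zero_add]
      exact (Finset.card_le_card h9).trans Finset.card_le_two
  · have h9 : (Finset.univ.filter fun w : F × F =>
          (w.1 + w.2, w.1 * w.2) = (s, n)) = ∅ :=
      Finset.filter_eq_empty_iff.2 fun w _ h => hw ⟨w, h⟩
    rw [h9, Finset.card_empty, add_zero]
    rcases Finset.eq_empty_or_nonempty (Finset.univ.filter fun z : E =>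
      (Algebra.trace F E z, Algebra.norm F z) = (s, n)) with h | ⟨z, hz⟩
    · rw [h, Finset.card_empty]
      exact Nat.zero_le 2
    · rw [Finset.mem_filter] at hz
      refine (Finset.card_le_card (t := {z, algebraMap F E s - z}) ?_).trans Finset.card_le_two
      intro u hu
      rw [Finset.mem_filter] at hu
      have h3 := hroot u hu.2
      rw [hquad z hz.2 u] at h3
      rw [Finset.mem_insert, Finset.mem_singleton]
      rcases mul_eq_zero.1 h3 with h | h
      · exact Or.inl (sub_eq_zero.1 h)
      · exact Or.inr (sub_eq_zero.1 h)

/-- Each fibre count is at most `2`, and the total `|E| + |F|^2 = 2|F|^2` leaves no room for strict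
inequality. -/
theorem card_trace_norm_add_card_add_mul (h2 : Module.finrank F E = 2) (s n : F) :
    (Finset.univ.filter fun z : E => (Algebra.trace F E z, Algebra.norm F z) = (s, n)).card +
      (Finset.univ.filter fun w : F × F => (w.1 + w.2, w.1 * w.2) = (s, n)).card = 2 := by
  have hE : Fintype.card E = Fintype.card F ^ 2 := by
    rw [Module.card_eq_pow_finrank (K := F), h2]
  have hsum : ∑ v : F × F,
      ((Finset.univ.filter fun z : E => (Algebra.trace F E z, Algebra.norm F z) = v).card +
      (Finset.univ.filter fun w : F × F => (w.1 + w.2, w.1 * w.2) = v).card) =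
      ∑ v : F × F, 2 := by
    rw [Finset.sum_add_distrib, ← Finset.card_eq_sum_card_fiberwise (fun _ _ => by simp),
      ← Finset.card_eq_sum_card_fiberwise (fun _ _ => by simp)]
    simp [hE]
    ring
  exact (Finset.sum_eq_sum_iff_of_le
    fun v _ => card_trace_norm_add_card_add_mul_le h2 v.1 v.2).1 hsum (s, n) (Finset.mem_univ _)

theorem sum_trace_norm_add_sum_add_mul (h2 : Module.finrank F E = 2) {R : Type*} [CommRing R]
    (g : F × F → R) :
    ∑ z : E, g (Algebra.trace F E z, Algebra.norm F z) + ∑ w : F × F, g (w.1 + w.2, w.1 * w.2) =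
      2 * ∑ v : F × F, g v := by
  rw [sum_comp_eq_sum_card_mul g (fun z : E => (Algebra.trace F E z, Algebra.norm F z)),
    sum_comp_eq_sum_card_mul g (fun w : F × F => (w.1 + w.2, w.1 * w.2)), ← Finset.sum_add_distrib, Finset.mul_sum]
  refine Finset.sum_congr rfl fun v _ => ?_
  rw [← add_mul, ← Nat.cast_add, card_trace_norm_add_card_add_mul h2 v.1 v.2, Nat.cast_two]

end Quadratic

theorem sum_units_eq_sum_ite {F : Type*} [Field F] [Fintype F] [DecidableEq F] {R : Type*}
    [CommRing R] (f : F → R) : ∑ x : Fˣ, f x = ∑ x : F, if x = 0 then 0 else f x := by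
  have h : ∑ x : F, (if x = 0 then 0 else f x) = ∑ x : F with x ≠ 0, f x := by
    rw [Finset.sum_filter]
    exact Finset.sum_congr rfl fun x _ => by by_cases hx : x = 0 <;> simp [hx]
  rw [h, Finset.sum_subtype (p := fun x : F => x ≠ 0) (Finset.univ.filter fun x : F => x ≠ 0) (by simp)]
  exact Fintype.sum_equiv unitsEquivNeZero _ _ fun x => rfl

/-- Both `Kl_{q^2}` and `Kl_q^2` sum the same function `g(s, n) = ψ(s(1 + t/n))`, over (trace, norm)
and over (sum, product) respectively, since `x + t/x + y + t/y = (x + y)(1 + t/(xy))`. Together they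
cover every `(s, n)` twice. -/
theorem kloostermanSum_of_finrank_eq_two {p : ℕ} [Fact p.Prime] {F E : Type*} [Field F] [Fintype F]
    [DecidableEq F] [Algebra (ZMod p) F] [Field E] [Fintype E] [DecidableEq E]
    [Algebra (ZMod p) E] [Algebra F E] [IsScalarTower (ZMod p) F E]
    (h2 : Module.finrank F E = 2) {R : Type*} [CommRing R] [IsDomain R] {ζ : R}
    (hζ : IsPrimitiveRoot ζ p) (t : Fˣ) :
    kloostermanSum p ζ (Units.map (algebraMap F E : F →* E) t) =
      2 * Fintype.card F - kloostermanSum p ζ t ^ 2 := by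
  set ψ : F → R := fun a => AddChar.zmodChar p hζ.pow_eq_one (Algebra.trace (ZMod p) F a) with hψ
  have hψadd : ∀ a b, ψ (a + b) = ψ a * ψ b := fun a b => by
    simp [hψ, AddChar.map_add_eq_mul]
  set g : F × F → R := fun v => if v.2 = 0 then 0 else ψ (v.1 * (1 + t / v.2)) with hg
  have hE : kloostermanSum p ζ (Units.map (algebraMap F E : F →* E) t) =
      ∑ z : E, g (Algebra.trace F E z, Algebra.norm F z) := by
    rw [kloostermanSum_eq_sum_addChar hζ.pow_eq_one]
    rw [sum_units_eq_sum_ite fun x : E => AddChar.zmodChar p hζ.pow_eq_one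
      (Algebra.trace (ZMod p) E (x + (Units.map (algebraMap F E : F →* E) t : E) / x))]
    refine Finset.sum_congr rfl fun z _ => ?_
    simp only [hg, Algebra.norm_eq_zero_iff]
    split_ifs with hz
    · rfl
    · rw [← Algebra.trace_trace (S := F)]
      simp only [hψ, Units.coe_map, MonoidHom.coe_coe]
      rw [trace_add_div_of_finrank_eq_two h2 hz]
  have hF : kloostermanSum p ζ t ^ 2 = ∑ w : F × F, g (w.1 + w.2, w.1 * w.2) := by
    rw [kloostermanSum_eq_sum_addChar hζ.pow_eq_one,
      sum_units_eq_sum_ite fun x : F => ψ (x + (t : F) / x), sq, Finset.sum_mul_sum,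
      ← Finset.univ_product_univ, Finset.sum_product]
    refine Finset.sum_congr rfl fun x _ => Finset.sum_congr rfl fun y _ => ?_
    simp only [hg]
    by_cases hx : x = 0
    · simp [hx]
    by_cases hy : y = 0
    · simp [hy]
    rw [if_neg hx, if_neg hy, if_neg (mul_ne_zero hx hy), ← hψadd]
    congr 1
    field_simp
    ring
  -- For fixed `n ≠ 0` the sum over `s` vanishes by orthogonality unless `1 + t/n = 0`; only `n =
  -- -t` contributes.
  have hG : ∑ v : F × F, g v = Fintype.card F := by
    rw [← Finset.univ_product_univ, Finset.sum_product_right,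
      Finset.sum_eq_single (-(t : F))]
    · simp [hg, hψ]
    · intro n _ hn
      by_cases hn0 : n = 0
      · simp [hg, hn0]
      · simp only [hg, if_neg hn0]
        refine sum_zmodChar_trace_mul hζ ?_
        intro h
        apply hn
        field_simp at h
        linear_combination h
    · simp
  have := sum_trace_norm_add_sum_add_mul h2 g
  rw [hE, hF, ← hG]
  linear_combination this

/-! ### Stepanov's method over fields of square order -/

section Stepanov

open Polynomial

theorem exists_ne_zero_sum_C_mul_eq_zero {K ι : Type*} [Field K] [Fintype ι] (v : ι → K[X]) {M : ℕ}
    (hv : ∀ i, (v i).degree < M) (hM : M < Fintype.card ι) :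
    ∃ τ : ι → K, τ ≠ 0 ∧ ∑ i, C (τ i) * v i = 0 := by
  let T : (ι → K) →ₗ[K] (Fin M → K) := LinearMap.pi fun n =>
    (Polynomial.lcoeff K n).comp (Fintype.linearCombination K v)
  have hT : LinearMap.ker T ≠ ⊥ := T.ker_ne_bot_of_finrank_lt (by simpa using hM)
  obtain ⟨τ, hτ, hτ0⟩ := Submodule.exists_mem_ne_zero_of_ne_bot hT
  refine ⟨τ, hτ0, ?_⟩
  ext n
  by_cases hn : n < M
  · have := congrFun (LinearMap.mem_ker.1 hτ) ⟨n, hn⟩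
    simpa [T, Fintype.linearCombination_apply] using this
  · rw [coeff_zero]
    refine coeff_eq_zero_of_degree_lt ((degree_sum_le _ _).trans_lt
      ((Finset.sup_lt_iff (by exact_mod_cast WithBot.bot_lt_coe n)).2 fun i _ => ?_))
    rw [← smul_eq_C_mul]
    exact ((degree_smul_le _ _).trans_lt (hv i)).trans_le (by exact_mod_cast not_lt.1 hn)

theorem sum_C_mul_ne_zero_of_injective_natDegree {K ι : Type*} [Field K] [Fintype ι]
    {u : ι → K[X]} (hu : ∀ i, (u i).Monic) (hinj : Function.Injective fun i => (u i).natDegree)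
    {σ : ι → K} (hσ : σ ≠ 0) : ∑ i, C (σ i) * u i ≠ 0 := by
  have hdeg : ∀ i, σ i ≠ 0 → (C (σ i) * u i).degree = (u i).natDegree := fun i hi => by
    rw [degree_C_mul hi, degree_eq_natDegree (hu i).ne_zero]
  have hne : ∀ i, C (σ i) * u i ≠ 0 → σ i ≠ 0 := fun i hi h => hi (by rw [h, C_0, zero_mul])
  obtain ⟨i, hi⟩ := Function.ne_iff.1 hσ
  intro h0
  have h := degree_sum_eq_of_disjoint (fun i => C (σ i) * u i) Finset.univ (by
    rintro i ⟨-, hi⟩ j ⟨-, hj⟩ hij h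
    simp only [Function.comp_apply] at h
    rw [hdeg i (hne i hi), hdeg j (hne j hj)] at h
    exact hij (hinj (by exact_mod_cast h)))
  rw [h0, degree_zero] at h
  have h1 := Finset.le_sup (f := fun i => (C (σ i) * u i).degree) (Finset.mem_univ i)
  rw [← h] at h1
  simp only [hdeg i hi] at h1
  exact absurd h1 (by simp)

/-- With `D = p^k`, `P = p^(k+1)`, take `G = ∑ τ_i^P u_i`. At a point satisfying the equation,
`x^(P^2) = x` and the equation for `w^P` turn `G(x)^P x^((p-1)D)` into `x^((p-1)DP) ∑ τ_i v_i(x)`.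
The `v_i` have low degree, so some `τ ≠ 0` kills `∑ τ_i v_i`; the `u_i` have distinct degrees, so `G
≠ 0`. -/
theorem exists_stepanov_polynomial {p : ℕ} [Fact p.Prime] {F : Type*} [Field F] [Fintype F]
    [CharP F p] {k : ℕ} (hk : k ≠ 0) (hF : Fintype.card F = (p ^ (k + 1)) ^ 2) {w : F[X]}
    (hw : w.Monic) (hwd : w.natDegree = 2 * p ^ k) (c : F) :
    ∃ G : F[X], G ≠ 0 ∧ G.natDegree ≤ p ^ k * p ^ (k + 1) + 2 * p ^ (k + 1) ∧
      ∀ x : F, x ≠ 0 → w.eval x ^ p ^ (k + 1) * x ^ p ^ k =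
        x ^ (p ^ k * p ^ (k + 1)) * (c * x ^ p ^ k - w.eval x) → G.eval x = 0 := by
  have hp := (Fact.out : p.Prime)
  have hpow : ∀ a : F, a ^ (p ^ (k + 1) * p ^ (k + 1)) = a := fun a => by
    rw [← sq, ← hF, FiniteField.pow_card]
  have hPD : p ^ (k + 1) = p ^ k * p := pow_succ p k
  have hD2 : 2 ≤ p ^ k := hp.two_le.trans (Nat.le_self_pow hk p)
  have hP0 : p ^ (k + 1) ≠ 0 := pow_ne_zero _ hp.ne_zero
  have hfrob : ∀ (s : Finset (Fin (p ^ k) × Fin (p ^ k + 1) × Fin p)) (f : _ → F),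
      (∑ i ∈ s, f i) ^ p ^ (k + 1) = ∑ i ∈ s, f i ^ p ^ (k + 1) :=
    fun s f => sum_pow_char_pow p (k + 1) s f
  generalize p ^ (k + 1) = P at *
  generalize p ^ k = D at *
  let v : Fin D × Fin (D + 1) × Fin p → F[X] := fun i =>
    X ^ (i.1 * P + i.2.1 + (p - 1 - i.2.2) * D : ℕ) * (C c * X ^ D - w) ^ (i.2.2 : ℕ)
  let u : Fin D × Fin (D + 1) × Fin p → F[X] := fun i =>
    X ^ (i.1 + i.2.1 * P + (p - 1 - i.2.2) * D : ℕ) * w ^ (i.2.2 : ℕ)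
  have hu : ∀ i, (u i).Monic := fun i => (monic_X_pow _).mul (hw.pow _)
  have hud : ∀ i, (u i).natDegree = i.1 + i.2.1 * P + i.2.2 * D + (p - 1) * D := by
    rintro ⟨j, a, b, hb⟩
    rw [(monic_X_pow _).natDegree_mul (hw.pow _), natDegree_X_pow, hw.natDegree_pow, hwd]
    obtain ⟨e, he⟩ := Nat.exists_eq_add_of_le (Nat.le_sub_one_of_lt hb)
    simp only [he, Nat.add_sub_cancel_left]
    ring
  -- Up to a constant the degree is `j + D(b + pa)` with `j < D` and `b < p`: a mixed-radix
  -- expansion, so its digits are determined.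
  have hinj : Function.Injective fun i => (u i).natDegree := by
    rintro ⟨⟨j, hj⟩, ⟨a, ha⟩, ⟨b, hb⟩⟩ ⟨⟨j', hj'⟩, ⟨a', ha'⟩, ⟨b', hb'⟩⟩ h
    simp only [hud] at h
    have hD0 : 0 < D := by omega
    have h1 : j + D * (b + p * a) = j' + D * (b' + p * a') := by
      have h0 : j + a * P + b * D = j' + a' * P + b' * D := by omega
      rw [hPD] at h0
      linarith
    have hjj : j = j' := by
      have := congrArg (· % D) h1
      simpa [Nat.add_mul_mod_self_left, Nat.mod_eq_of_lt hj, Nat.mod_eq_of_lt hj'] using this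
    subst hjj
    have h2 : b + p * a = b' + p * a' := Nat.eq_of_mul_eq_mul_left hD0 (by omega)
    have hbb : b = b' := by
      have := congrArg (· % p) h2
      simpa [Nat.add_mul_mod_self_left, Nat.mod_eq_of_lt hb, Nat.mod_eq_of_lt hb'] using this
    subst hbb
    have haa : a = a' := Nat.eq_of_mul_eq_mul_left hp.pos (by omega)
    subst haa
    rfl
  have hvd : ∀ i, (v i).degree < ((D + 1) * P + 1 - D : ℕ) := by
    rintro ⟨⟨j, hj⟩, ⟨a, ha⟩, ⟨b, hb⟩⟩
    refine degree_le_natDegree.trans_lt ?_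
    have h1 : (C c * X ^ D - w).natDegree ≤ 2 * D := by
      refine (natDegree_sub_le _ _).trans (max_le ?_ hwd.le)
      exact (natDegree_C_mul_X_pow_le _ _).trans (by omega)
    have h2 : (v (⟨j, hj⟩, ⟨a, ha⟩, ⟨b, hb⟩)).natDegree ≤
        (j * P + a + (p - 1 - b) * D) + b * (2 * D) := by
      refine natDegree_mul_le.trans (add_le_add (natDegree_X_pow_le _) ?_)
      exact natDegree_pow_le.trans (Nat.mul_le_mul_left _ h1)
    refine lt_of_le_of_lt (WithBot.coe_le_coe.2 h2) ?_
    obtain ⟨e, he⟩ := Nat.exists_eq_add_of_le (Nat.le_sub_one_of_lt hb)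
    have hpe : p = b + e + 1 := by have := hp.one_le; omega
    have h3 : j * P + P ≤ D * P := by
      rw [← Nat.succ_mul]; exact Nat.mul_le_mul_right _ hj
    have h4 : P = b * D + e * D + D := by rw [hPD, hpe]; ring
    have h5 : p - 1 - b = e := by omega
    rw [h5]
    have h6 : (D + 1) * P = D * P + P := by ring
    have h7 : b * (2 * D) = b * D + b * D := by ring
    refine WithBot.coe_lt_coe.2 ?_
    change _ < (D + 1) * P + 1 - D
    rw [h6, h7]
    omega
  -- There are `(D + 1)P` unknowns and `(D + 1)P + 1 - D` equations; `D ≥ 2`, that is `k ≠ 0`, is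
  -- what makes a nonzero solution exist.
  obtain ⟨τ, hτ0, hτ⟩ := exists_ne_zero_sum_C_mul_eq_zero v hvd (by
    simp only [Fintype.card_prod, Fintype.card_fin]
    have : D * ((D + 1) * p) = (D + 1) * P := by rw [hPD]; ring
    rw [this]
    have : D ≤ (D + 1) * P := by
      rw [← this]; exact Nat.le_mul_of_pos_right _ (Nat.mul_pos (Nat.succ_pos _) hp.pos)
    omega)
  have hσ0 : (fun i => τ i ^ P) ≠ 0 := by
    obtain ⟨i, hi⟩ := Function.ne_iff.1 hτ0
    exact Function.ne_iff.2 ⟨i, pow_ne_zero _ hi⟩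
  refine ⟨∑ i, C (τ i ^ P) * u i, sum_C_mul_ne_zero_of_injective_natDegree hu hinj hσ0, ?_, ?_⟩
  · refine natDegree_sum_le_of_forall_le _ _ fun i _ => (natDegree_C_mul_le _ _).trans ?_
    rw [hud]
    obtain ⟨⟨j, hj⟩, ⟨a, ha⟩, ⟨b, hb⟩⟩ := i
    simp only
    have h1 : a * P ≤ D * P := Nat.mul_le_mul_right _ (Nat.lt_succ_iff.1 ha)
    have h2 : b * D + D ≤ P := by
      rw [← Nat.succ_mul, hPD, mul_comm D]; exact Nat.mul_le_mul_right _ hb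
    have h3 : (p - 1) * D ≤ P := by
      rw [hPD, mul_comm D]; exact Nat.mul_le_mul_right _ (Nat.sub_le _ _)
    omega
  · intro x hx hwx
    have hHx := congrArg (Polynomial.eval x) hτ
    simp only [eval_finsetSum, eval_mul, eval_C, v, u, eval_pow, eval_X, eval_sub, eval_zero] at hHx ⊢
    have hkey : (∑ i : Fin D × Fin (D + 1) × Fin p, τ i ^ P *
        (x ^ (i.1 + i.2.1 * P + (p - 1 - i.2.2) * D : ℕ) * w.eval x ^ (i.2.2 : ℕ))) ^ P *
          x ^ ((p - 1) * D) = 0 := by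
      rw [hfrob, Finset.sum_mul, ← mul_zero (x ^ ((p - 1) * (D * P))), ← hHx, Finset.mul_sum]
      refine Finset.sum_congr rfl fun i _ => ?_
      obtain ⟨⟨j, hj⟩, ⟨a, ha⟩, ⟨b, hb⟩⟩ := i
      simp only
      obtain ⟨e, he⟩ := Nat.exists_eq_add_of_le (Nat.le_sub_one_of_lt hb)
      rw [he, Nat.add_sub_cancel_left]
      have e1 : ∀ z : F, (τ (⟨j, hj⟩, ⟨a, ha⟩, ⟨b, hb⟩) ^ P * (x ^ (j + a * P + e * D) * z ^ b)) ^ P =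
          τ (⟨j, hj⟩, ⟨a, ha⟩, ⟨b, hb⟩) ^ (P * P) * (x ^ (j * P) * (x ^ (P * P)) ^ a *
            x ^ (e * D * P) * (z ^ P) ^ b) := fun z => by ring
      rw [e1, hpow, hpow]
      have e2 : ∀ y z : F, y * (x ^ (j * P) * x ^ a * x ^ (e * D * P) * z ^ b) *
          x ^ ((b + e) * D) = y * (x ^ (j * P) * x ^ a * x ^ (e * D * P) * x ^ (e * D)) *
          (z * x ^ D) ^ b := fun y z => by ring
      rw [e2, hwx, mul_pow]
      ring
    rcases mul_eq_zero.1 hkey with h | h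
    · exact (pow_eq_zero_iff hP0).1 h
    · exact absurd h (pow_ne_zero _ hx)

theorem monic_natDegree_sum_X_pow_mul_pow {p : ℕ} (hp : 1 < p) {F : Type*} [Field F]
    (k : ℕ) (t : F) :
    (∑ i ∈ Finset.range (k + 1), X ^ (p ^ k - p ^ i) * (X ^ 2 + C t) ^ p ^ i : F[X]).Monic ∧
    (∑ i ∈ Finset.range (k + 1), X ^ (p ^ k - p ^ i) * (X ^ 2 + C t) ^ p ^ i : F[X]).natDegree =
      2 * p ^ k := by
  have h1 : (X ^ 2 + C t : F[X]).Monic := monic_X_pow_add_C _ two_ne_zero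
  have hd1 : (X ^ 2 + C t : F[X]).natDegree = 2 := natDegree_X_pow_add_C
  have hm : ((X ^ 2 + C t : F[X]) ^ p ^ k).Monic := h1.pow _
  have hd : ((X ^ 2 + C t : F[X]) ^ p ^ k).natDegree = 2 * p ^ k := by
    rw [h1.natDegree_pow, hd1, mul_comm]
  have hlt : (∑ i ∈ Finset.range k, X ^ (p ^ k - p ^ i) * (X ^ 2 + C t) ^ p ^ i : F[X]).degree <
      ((X ^ 2 + C t : F[X]) ^ p ^ k).degree := by
    rw [degree_eq_natDegree hm.ne_zero, hd]
    refine (degree_sum_le _ _).trans_lt ((Finset.sup_lt_iff (WithBot.bot_lt_coe _)).2 fun i hi => ?_)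
    rw [Finset.mem_range] at hi
    have hlt : p ^ i < p ^ k := Nat.pow_lt_pow_right hp hi
    refine degree_le_natDegree.trans_lt ?_
    rw [(monic_X_pow _).natDegree_mul (h1.pow _), natDegree_X_pow, h1.natDegree_pow, hd1]
    norm_cast
    omega
  rw [Finset.sum_range_succ, Nat.sub_self, pow_zero, one_mul, add_comm]
  exact ⟨hm.add_of_left hlt, by rw [natDegree_add_eq_left_of_degree_lt hlt, hd]⟩

/-- The half trace `g = ∑_{i ≤ k} y^(p^i)` of `y = x + t/x` satisfies `g + g^P = Tr y`, where `P =
p^(k+1)`. Clearing denominators, `w(x) = x^(p^k) g`, which gives the equation required by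
`exists_stepanov_polynomial`. -/
theorem card_trace_add_div_eq_le {p : ℕ} [Fact p.Prime] {F : Type*} [Field F] [Fintype F]
    [DecidableEq F] [Algebra (ZMod p) F] {k : ℕ} (hk : k ≠ 0)
    (hF : Fintype.card F = (p ^ (k + 1)) ^ 2) (t : F) (c : ZMod p) :
    (Finset.univ.filter fun x : Fˣ =>
      Algebra.trace (ZMod p) F ((x : F) + t / (x : F)) = c).card ≤
      p ^ k * p ^ (k + 1) + 2 * p ^ (k + 1) := by
  have hp := (Fact.out : p.Prime)
  have : CharP F p := charP_of_injective_algebraMap (algebraMap (ZMod p) F).injective p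
  have hfin : Module.finrank (ZMod p) F = (k + 1) + (k + 1) := by
    have h1 := Module.card_eq_pow_finrank (K := ZMod p) (V := F)
    rw [hF, ZMod.card, ← pow_mul] at h1
    have := Nat.pow_right_injective hp.two_le h1
    omega
  obtain ⟨hm, hd⟩ := monic_natDegree_sum_X_pow_mul_pow hp.one_lt k t
  set w : F[X] := ∑ i ∈ Finset.range (k + 1), X ^ (p ^ k - p ^ i) * (X ^ 2 + C t) ^ p ^ i with hw
  obtain ⟨G, hG0, hGd, hG⟩ := exists_stepanov_polynomial hk hF hm hd (algebraMap (ZMod p) F c)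
  refine le_trans ?_ hGd
  rw [← Finset.card_map ⟨Units.val, Units.val_injective⟩]
  refine card_le_degree_of_subset_roots fun x hx => ?_
  simp only [Finset.mem_val, Finset.mem_map, Finset.mem_filter, Finset.mem_univ, true_and,
    Function.Embedding.coeFn_mk] at hx
  obtain ⟨x, hx, rfl⟩ := hx
  rw [mem_roots hG0, IsRoot.def]
  have hx0 : (x : F) ≠ 0 := x.ne_zero
  apply hG _ hx0
  set y : F := (x : F) + t / (x : F) with hy
  set g : F := ∑ i ∈ Finset.range (k + 1), y ^ p ^ i with hg
  have hxy : (x : F) ^ 2 + t = x * y := by rw [hy]; field_simp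
  have hwg : w.eval (x : F) = (x : F) ^ p ^ k * g := by
    rw [hw, eval_finsetSum, hg, Finset.mul_sum]
    refine Finset.sum_congr rfl fun i hi => ?_
    have hle : p ^ i ≤ p ^ k :=
      Nat.pow_le_pow_right hp.pos (Nat.lt_succ_iff.1 (Finset.mem_range.1 hi))
    rw [eval_mul, eval_pow, eval_pow, eval_add, eval_pow, eval_X, eval_C, hxy, mul_pow, ← mul_assoc,
      ← pow_add, Nat.sub_add_cancel hle]
  have htr : g + g ^ p ^ (k + 1) = algebraMap (ZMod p) F c := by
    rw [← hx, FiniteField.algebraMap_trace_eq_sum_pow, hfin, Finset.sum_range_add, Nat.card_zmod, hg,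
      sum_pow_char_pow p (k + 1)]
    congr 1
    refine Finset.sum_congr rfl fun i _ => ?_
    rw [← pow_mul, ← pow_add, add_comm]
  rw [hwg, ← htr]
  ring

/-- Upper bounds on the fibres suffice: as `∑ ζ^c = 0`, each `N c` may be replaced by `N c - B`, of
constant sign, and `∑ (B - N c) = pB - (q - 1)` has no term of order `q` because `B` is `q/p + 2√q`.
-/
theorem norm_kloostermanSum_le {p : ℕ} [Fact p.Prime] {F : Type*} [Field F] [Fintype F]
    [DecidableEq F] [Algebra (ZMod p) F] {k : ℕ} (hk : k ≠ 0)
    (hF : Fintype.card F = (p ^ (k + 1)) ^ 2) {ζ : ℂ} (hζ : IsPrimitiveRoot ζ p) (t : Fˣ) :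
    ‖kloostermanSum p ζ t‖ ≤ (2 * p + 1) * p ^ (k + 1) := by
  have hp := (Fact.out : p.Prime)
  set B : ℕ := p ^ k * p ^ (k + 1) + 2 * p ^ (k + 1) with hB
  set N : ZMod p → ℕ := fun c => (Finset.univ.filter fun x : Fˣ =>
      Algebra.trace (ZMod p) F ((x : F) + t / (x : F)) = c).card with hN
  have hNB : ∀ c, N c ≤ B := card_trace_add_div_eq_le hk hF (t : F)
  have hne : AddChar.zmodChar p hζ.pow_eq_one ≠ 1 := by
    rw [AddChar.zmod_char_ne_one_iff, AddChar.zmodChar_apply, ZMod.val_one, pow_one]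
    exact hζ.ne_one hp.one_lt
  have hz : ∑ c : ZMod p, ζ ^ c.val = 0 := AddChar.sum_eq_zero_of_ne_one hne
  have hkl : kloostermanSum p ζ t = -∑ c : ZMod p, ((B - N c : ℕ) : ℂ) * ζ ^ c.val := by
    have h1 : kloostermanSum p ζ t = ∑ c : ZMod p, (N c : ℂ) * ζ ^ c.val :=
      sum_comp_eq_sum_card_mul (fun c : ZMod p => ζ ^ c.val)
        fun x : Fˣ => Algebra.trace (ZMod p) F ((x : F) + t / (x : F))
    have h2 : ∑ c : ZMod p, ((B - N c : ℕ) : ℂ) * ζ ^ c.val =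
        B * ∑ c : ZMod p, ζ ^ c.val - ∑ c : ZMod p, (N c : ℂ) * ζ ^ c.val := by
      rw [Finset.mul_sum, ← Finset.sum_sub_distrib]
      refine Finset.sum_congr rfl fun c _ => ?_
      rw [Nat.cast_sub (hNB c)]
      ring
    rw [h1, h2, hz]
    ring
  have hsumN : ∑ c, N c = Fintype.card F - 1 := by
    rw [← Fintype.card_units, ← Finset.card_univ (α := Fˣ)]
    exact (Finset.card_eq_sum_card_fiberwise (fun _ _ => by simp)).symm
  have hsum : ∑ c, (B - N c) + ∑ c, N c = p * B := by
    rw [← Finset.sum_add_distrib, Finset.sum_congr rfl fun c _ => Nat.sub_add_cancel (hNB c)]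
    simp [ZMod.card]
  have hbound : ∑ c, (B - N c) ≤ (2 * p + 1) * p ^ (k + 1) := by
    have h1 : p * B = Fintype.card F + 2 * p * p ^ (k + 1) := by
      rw [hF, hB]; ring
    have h2 : 1 ≤ p ^ (k + 1) := Nat.one_le_pow _ _ hp.pos
    have h3 : 0 < Fintype.card F := Fintype.card_pos
    rw [add_mul, one_mul]
    omega
  rw [hkl, norm_neg]
  calc ‖∑ c : ZMod p, ((B - N c : ℕ) : ℂ) * ζ ^ c.val‖
      ≤ ∑ c : ZMod p, ((B - N c : ℕ) : ℝ) := by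
        refine (norm_sum_le _ _).trans (Finset.sum_le_sum fun c _ => ?_)
        rw [norm_mul, norm_pow, hζ.norm'_eq_one hp.ne_zero, one_pow, mul_one, Complex.norm_natCast]
    _ ≤ (2 * p + 1) * p ^ (k + 1) := by exact_mod_cast hbound

end Stepanov

/-! ### Reality, strictness and amplification of the bound -/

theorem conj_kloostermanSum {p : ℕ} [Fact p.Prime] {F : Type*} [Field F] [Fintype F]
    [DecidableEq F] [Algebra (ZMod p) F] {ζ : ℂ} (hζ : ζ ^ p = 1) (t : Fˣ) :
    (starRingEnd ℂ) (kloostermanSum p ζ t) = kloostermanSum p ζ t := by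
  rw [kloostermanSum_eq_sum_addChar hζ, map_sum]
  refine Fintype.sum_equiv (Equiv.neg Fˣ) _ _ fun x => ?_
  rw [← AddChar.map_neg_eq_conj, ← map_neg]
  congr 2
  simp only [Equiv.neg_apply, Units.val_neg, div_neg, neg_add]

theorem kloostermanSum_sq_ne_four_mul_pow {p : ℕ} [Fact p.Prime] {m : ℕ} (hm : m ≠ 0)
    {F : Type*} [Field F] [Fintype F] [DecidableEq F] [Algebra (ZMod p) F]
    (hF : Fintype.card F = p ^ m) {L : Type*} [Field L] [CharZero L] {ζ : L} (hζ : ζ ^ p = 1)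
    (t : Fˣ) : kloostermanSum p ζ t ^ 2 ≠ 4 * (p : L) ^ m := by
  have hp := (Fact.out : p.Prime)
  intro hK
  set O := integralClosure ℤ L
  have hζO : ζ ∈ O := IsIntegral.of_pow hp.pos (by rw [hζ]; exact isIntegral_one)
  obtain ⟨e, he, hKe⟩ : ∃ e ∈ O, kloostermanSum p ζ t = ((p : L) ^ m - 1) + (ζ - 1) * e := by
    choose e he hζe using exists_mem_pow_eq_one_add O hζO
    refine ⟨∑ x : Fˣ,
      (fun n : ℕ => (n : L) + (ζ - 1) * e n)
        (Algebra.trace (ZMod p) F ((x : F) + (t : F) / (x : F))).val,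
      sum_mem fun x _ => add_mem (natCast_mem _ _)
        (mul_mem (sub_mem hζO (one_mem _)) (he _)), ?_⟩
    have h1 : ((p : L) ^ m - 1) = ∑ x : Fˣ, 1 := by
      rw [Finset.sum_const, Finset.card_univ, Fintype.card_units, hF, nsmul_eq_mul, mul_one,
        Nat.cast_sub (Nat.one_le_pow _ _ hp.pos)]
      push_cast
      ring
    rw [kloostermanSum, h1, Finset.mul_sum, ← Finset.sum_add_distrib]
    refine Finset.sum_congr rfl fun x _ => ?_
    rw [hζe]
    ring
  obtain ⟨f, hf, hζf⟩ : ∃ f ∈ O, (ζ - 1) ^ p = p * f := by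
    obtain ⟨r, hr⟩ := exists_add_pow_prime_eq hp (⟨ζ, hζO⟩ - 1 : O) 1
    have hr' := congrArg (algebraMap O L) hr
    refine ⟨-((ζ - 1) * r), neg_mem (mul_mem (sub_mem hζO (one_mem _)) r.2), ?_⟩
    have h2 : ζ ^ p = (ζ - 1) ^ p + 1 + p * (ζ - 1) * r := by
      simpa [Algebra.algebraMap_ofSubsemiring_apply] using hr'
    linear_combination hζ - h2
  obtain ⟨m, rfl⟩ := Nat.exists_eq_succ_of_ne_zero hm
  -- Chosen so that `(q - 1)^2 - 4q = 1 + ps`, with `q = p^(m+1)` after the shift of `m`.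
  set s : ℤ := (p : ℤ) ^ m * ((p : ℤ) ^ (m + 1) - 6) with hs
  obtain ⟨e', he', hse⟩ : ∃ e' ∈ O, 1 + (p : L) * s = (ζ - 1) * e' := by
    refine ⟨-(e * (2 * ((p : L) ^ (m + 1) - 1) + (ζ - 1) * e)), neg_mem (mul_mem he (add_mem
      (mul_mem (by exact_mod_cast natCast_mem O 2)
        (sub_mem (pow_mem (natCast_mem _ _) _) (one_mem _)))
      (mul_mem (sub_mem hζO (one_mem _)) he))), ?_⟩
    rw [hKe] at hK
    rw [hs]
    push_cast
    rw [Nat.succ_eq_add_one] at hK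
    linear_combination hK
  -- The `p`-th power of `1 + ps = (ζ - 1)e'` is `1` modulo `p`, yet divisible by `p` because `(ζ -
  -- 1)^p` is.
  obtain ⟨u, hu⟩ : (p : ℤ) ∣ (1 + p * s) ^ p - 1 := by
    have h1 := sub_dvd_pow_sub_pow (1 + (p : ℤ) * s) 1 p
    rw [one_pow, add_sub_cancel_left] at h1
    exact (Dvd.intro _ rfl).trans h1
  have hu' : (1 + (p : L) * s) ^ p - 1 = p * u := by exact_mod_cast congrArg (Int.cast : ℤ → L) hu
  have hg : IsIntegral ℤ (f * e' ^ p - u) :=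
    (sub_mem (mul_mem hf (pow_mem he' _)) (intCast_mem O u) : f * e' ^ p - u ∈ O)
  have hpg : (p : L) * (f * e' ^ p - u) = 1 := by
    rw [hse, mul_pow, hζf] at hu'
    linear_combination hu'
  have hpQ : (p : ℚ) ≠ 0 := by exact_mod_cast hp.ne_zero
  have hgq : f * e' ^ p - u = algebraMap ℚ L (p : ℚ)⁻¹ := by
    rw [map_inv₀, map_natCast]
    exact eq_inv_of_mul_eq_one_right hpg
  rw [hgq, isIntegral_algebraMap_iff (algebraMap ℚ L).injective, IsIntegrallyClosed.isIntegral_iff]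
    at hg
  obtain ⟨y, hy⟩ := hg
  have hy' : (y * p : ℚ) = 1 := by
    rw [show (y : ℚ) = (p : ℚ)⁻¹ from hy, inv_mul_cancel₀ hpQ]
  have hy2 : y * (p : ℤ) = 1 := by exact_mod_cast hy'
  have := Int.isUnit_iff_natAbs_eq.1 (IsUnit.of_mul_eq_one_right _ hy2)
  simp only [Int.natAbs_natCast] at this
  exact hp.one_lt.ne' this

/-- `|2q - K^2| ≥ |K|^2 - 2q ≥ ((2 + δ)^2 - 2)q ≥ (2 + 4δ)q`. -/
theorem exists_quadratic_extension_mul_sqrt_le_norm_kloostermanSum {p : ℕ} [Fact p.Prime] {m : ℕ}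
    {F : Type*} [Field F] [Fintype F] [DecidableEq F] [Algebra (ZMod p) F]
    (hF : Fintype.card F = p ^ m) {ζ : ℂ} (hζ : IsPrimitiveRoot ζ p) (t : Fˣ) {δ : ℝ} (hδ : 0 ≤ δ)
    (h : (2 + δ) * √((p : ℝ) ^ m) ≤ ‖kloostermanSum p ζ t‖) :
    ∃ (E : Type) (_ : Field E) (_ : Fintype E) (_ : DecidableEq E) (_ : Algebra (ZMod p) E)
      (u : Eˣ), Fintype.card E = p ^ (2 * m) ∧
        (2 + 4 * δ) * √((p : ℝ) ^ (2 * m)) ≤ ‖kloostermanSum p ζ u‖ := by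
  classical
  have : CharP F p := charP_of_injective_algebraMap (algebraMap (ZMod p) F).injective p
  let E := FiniteField.Extension F p 2
  let _ : Fintype E := Fintype.ofFinite E
  have h2 : Module.finrank F E = 2 := FiniteField.finrank_extension F p 2
  refine ⟨E, inferInstance, inferInstance, inferInstance, inferInstance,
    Units.map (algebraMap F E : F →* E) t, ?_, ?_⟩
  · rw [Module.card_eq_pow_finrank (K := F), h2, hF, ← pow_mul, mul_comm]
  · rw [kloostermanSum_of_finrank_eq_two h2 hζ t, norm_sub_rev]
    have hq : (0 : ℝ) ≤ (p : ℝ) ^ m := by positivity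
    have h3 : √((p : ℝ) ^ (2 * m)) = (p : ℝ) ^ m := by
      rw [mul_comm, pow_mul, Real.sqrt_sq hq]
    have h4 : √((p : ℝ) ^ m) ^ 2 = (p : ℝ) ^ m := Real.sq_sqrt hq
    have h5 : ((2 + δ) * √((p : ℝ) ^ m)) ^ 2 ≤ ‖kloostermanSum p ζ t‖ ^ 2 :=
      pow_le_pow_left₀ (by positivity) h 2
    rw [mul_pow, h4] at h5
    have h6 := norm_sub_norm_le (kloostermanSum p ζ t ^ 2) (2 * (Fintype.card F : ℂ))
    rw [norm_pow, norm_mul, Complex.norm_ofNat, Complex.norm_natCast, hF] at h6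
    push_cast at h6
    rw [h3, hF]
    push_cast
    nlinarith [mul_nonneg (sq_nonneg δ) hq]

theorem norm_kloostermanSum_le_two_mul_sqrt {p : ℕ} [Fact p.Prime] {m : ℕ} (hm : m ≠ 0)
    {F : Type*} [Field F] [Fintype F] [DecidableEq F] [Algebra (ZMod p) F]
    (hF : Fintype.card F = p ^ m) {ζ : ℂ} (hζ : IsPrimitiveRoot ζ p) (t : Fˣ) :
    ‖kloostermanSum p ζ t‖ ≤ 2 * √((p : ℝ) ^ m) := by
  have hp := (Fact.out : p.Prime)
  have hp0 : (0 : ℝ) < p := by exact_mod_cast hp.pos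
  by_contra! hlt
  set q : ℝ := (p : ℝ) ^ m
  have hq : 0 < √q := Real.sqrt_pos.2 (by positivity)
  set δ : ℝ := ‖kloostermanSum p ζ t‖ / √q - 2 with hδ
  have hδ0 : 0 < δ := by rw [hδ, sub_pos, lt_div_iff₀ hq]; exact hlt
  have h0 : (2 + δ) * √q ≤ ‖kloostermanSum p ζ t‖ := by
    rw [hδ, add_sub_cancel, div_mul_cancel₀ _ hq.ne']
  have hall : ∀ n : ℕ, ∃ (E : Type) (_ : Field E) (_ : Fintype E) (_ : DecidableEq E)
      (_ : Algebra (ZMod p) E) (u : Eˣ), Fintype.card E = p ^ (2 ^ (n + 1) * m) ∧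
        (2 + 4 ^ (n + 1) * δ) * √((p : ℝ) ^ (2 ^ (n + 1) * m)) ≤ ‖kloostermanSum p ζ u‖ := by
    intro n
    induction n with
    | zero =>
      simpa using exists_quadratic_extension_mul_sqrt_le_norm_kloostermanSum hF hζ t hδ0.le h0
    | succ n ih =>
      obtain ⟨E, _, _, _, _, u, hE, hu⟩ := ih
      obtain ⟨E', i1, i2, i3, i4, u', hE', hu'⟩ :=
        exists_quadratic_extension_mul_sqrt_le_norm_kloostermanSum hE hζ u (by positivity) hu
      have e1 : 2 * (2 ^ (n + 1) * m) = 2 ^ (n + 1 + 1) * m := by ring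
      have e2 : 4 * (4 ^ (n + 1) * δ) = 4 ^ (n + 1 + 1) * δ := by ring
      rw [e1] at hE' hu'
      rw [e2] at hu'
      exact ⟨E', i1, i2, i3, i4, u', hE', hu'⟩
  obtain ⟨n, hn⟩ := pow_unbounded_of_one_lt ((2 * p + 1) / δ) (by norm_num : (1 : ℝ) < 4)
  -- The index `n + 1` makes `|E|` the square of `p^(k+1)` with `k + 1 = 2^(n+1) m` even, so that `k
  -- ≠ 0` as Stepanov's bound requires.
  obtain ⟨E, _, _, _, _, u, hE, hu⟩ := hall (n + 1)
  obtain ⟨k, hk⟩ : ∃ k, 2 ^ (n + 1) * m = k + 1 :=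
    Nat.exists_eq_succ_of_ne_zero (mul_ne_zero (by positivity) hm)
  have hk0 : k ≠ 0 := by
    rintro rfl
    have : 2 ∣ 2 ^ (n + 1) * m := ⟨2 ^ n * m, by ring⟩
    omega
  have hk2 : 2 ^ (n + 1 + 1) * m = (k + 1) * 2 := by rw [← hk]; ring
  rw [hk2, pow_mul] at hE hu
  rw [Real.sqrt_sq (by positivity)] at hu
  have h1 := hu.trans (norm_kloostermanSum_le hk0 hE hζ u)
  have h2 := le_of_mul_le_mul_right h1 (by positivity)
  rw [div_lt_iff₀ hδ0] at hn
  have h3 : (4 : ℝ) ^ n * δ ≤ 4 ^ (n + 1 + 1) * δ :=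
    mul_le_mul_of_nonneg_right (pow_le_pow_right₀ (by norm_num) (by omega)) hδ0.le
  linarith

theorem proposition2p1 (p : ℕ) [Fact p.Prime] (m : ℕ)
    (hpm : (3 ≤ p ∧ 1 ≤ m) ∨ (p = 2 ∧ 2 ≤ m))
    {F : Type*} [Field F] [Fintype F] [DecidableEq F] [Algebra (ZMod p) F]
    (hF : Fintype.card F = p ^ m) (t : Fˣ) :
    (∀ π ζ : AlgebraicClosure ℚ_[p], π ^ (p - 1) = -(p : AlgebraicClosure ℚ_[p]) →
      IsPrimitiveRoot ζ p →
      ∃ c ∈ Algebra.adjoin ℤ_[p] {π}, -kloostermanSum p ζ t - 1 = π ^ 2 * c) ∧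
    (∀ ζ : ℂ, IsPrimitiveRoot ζ p →
      ∃ r : ℝ, kloostermanSum p ζ t = (r : ℂ) ∧ r ^ 2 < 4 * (p : ℝ) ^ m) := by
  have : FaithfulSMul ℤ_[p] (AlgebraicClosure ℚ_[p]) := by
    rw [faithfulSMul_iff_algebraMap_injective, IsScalarTower.algebraMap_eq ℤ_[p] ℚ_[p]]
    exact (algebraMap ℚ_[p] (AlgebraicClosure ℚ_[p])).injective.comp
      (FaithfulSMul.algebraMap_injective ℤ_[p] ℚ_[p])
  refine ⟨fun π ζ hπ hζ => exists_neg_kloostermanSum_sub_one_eq hpm hF t hπ hζ, fun ζ hζ => ?_⟩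
  have hm : m ≠ 0 := by omega
  obtain ⟨r, hr⟩ := Complex.conj_eq_iff_real.1 (conj_kloostermanSum hζ.pow_eq_one t)
  refine ⟨r, hr, lt_of_le_of_ne ?_ ?_⟩
  · have h := norm_kloostermanSum_le_two_mul_sqrt hm hF hζ t
    rw [hr, Complex.norm_real, Real.norm_eq_abs] at h
    have h2 := pow_le_pow_left₀ (abs_nonneg r) h 2
    rw [sq_abs, mul_pow, Real.sq_sqrt (by positivity)] at h2
    linarith
  · intro h
    apply kloostermanSum_sq_ne_four_mul_pow hm hF hζ.pow_eq_one t
    rw [hr]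
    exact_mod_cast congrArg (Complex.ofReal) h
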